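/- Let $\mathfrak A,\mathfrak B$ be unital $C^*$-algebras, $\varphi,\varphi_1$ states on $\mathfrak A,\mathfrak B$, and $T:\mathfrak A\to\mathfrak A$, $H:\mathfrak B\to\mathfrak B$ unital completely positive maps with $\varphi\circ T=\varphi$ and $\varphi_1\circ H=\varphi_1$. Such a triple $(\mathfrak A,\varphi,T)$ is called a state preserving $C^*$-dynamical system; it is called strictly weak mixing if $$\lim_{n\to\infty}\frac1n\sum_{k=0}^{n-1}\bigl|\psi(T^k(x))-\psi(\mathbf 1)\varphi(x)\bigr|=0\qquad\text{for all }x\in\mathfrak A,\ \psi\in\mathfrak A^*,$$ where $\mathfrak A^*$ is the Banach dual of $\mathfrak A$. Let $\mathfrak A\otimes\mathfrak B$ be the minimal $C^*$-tensor product, let $T\otimes H$ be the unital completely positive map on it with $(T\otimes H)(x\otimes y)=Tx\otimes Hy$, and let $\varphi\otimes\varphi_1$ be the state on it with $(\varphi\otimes\varphi_1)(x\otimes y)=\varphi(x)\varphi_1(y)$; then $(\mathfrak A\otimes\mathfrak B,\varphi\otimes\varphi_1,T\otimes H)$ is a state preserving $C^*$-dynamical system. Let $\mathfrak A^*\otimes\mathfrak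 B^*\subseteq(\mathfrak A\otimes\mathfrak B)^*$ be the closure, in the dual norm, of the linear span of the functionals $\psi\otimes\phi$, $\psi\in\mathfrak A^*$, $\phi\in\mathfrak B^*$, where $(\psi\otimes\phi)(x\otimes y)=\psi(x)\phi(y)$. Consider the assertions (i) $(\mathfrak A\otimes\mathfrak B,\varphi\otimes\varphi_1,T\otimes H)$ is strictly weak mixing; (ii) $(\mathfrak A,\varphi,T)$ and $(\mathfrak B,\varphi_1,H)$ are both strictly weak mixing. Then (i) implies (ii). If in addition $(\mathfrak A\otimes\mathfrak B)^*=\mathfrak A^*\otimes\mathfrak B^*$, then (ii) implies (i). -/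

import Mathlib

open scoped TensorProduct ENNReal InnerProductSpace ComplexOrder CStarAlgebra

set_option linter.unusedSectionVars false

namespace CStarMixing

universe u v

noncomputable section

section HilbertTensor

variable {H K H' K' H'' K'' : Type*}
  [NormedAddCommGroup H] [InnerProductSpace ℂ H] [NormedAddCommGroup K] [InnerProductSpace ℂ K]
  [NormedAddCommGroup H'] [InnerProductSpace ℂ H'] [NormedAddCommGroup K'] [InnerProductSpace ℂ K']
  [NormedAddCommGroup H''] [InnerProductSpace ℂ H'']
  [NormedAddCommGroup K''] [InnerProductSpace ℂ K'']

/-- The Hilbert space tensor product: the completion of the algebraic tensor product. -/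
abbrev HilbertTensor (H K : Type*) [NormedAddCommGroup H] [InnerProductSpace ℂ H]
    [NormedAddCommGroup K] [InnerProductSpace ℂ K] : Type _ :=
  UniformSpace.Completion (H ⊗[ℂ] K)

/-- The bounded operator `S ⊗ R` between Hilbert space tensor products. -/
def opTensor (S : H →L[ℂ] H') (R : K →L[ℂ] K') : HilbertTensor H K →L[ℂ] HilbertTensor H' K' :=
  (TensorProduct.mapL S R).completion

theorem opTensor_coe (S : H →L[ℂ] H') (R : K →L[ℂ] K') (z : H ⊗[ℂ] K) :
    opTensor S R (z : HilbertTensor H K) =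
      ((TensorProduct.map S.toLinearMap R.toLinearMap z : H' ⊗[ℂ] K') : HilbertTensor H' K') := by
  simp [opTensor]

theorem opTensor_ext {E : Type*} [NormedAddCommGroup E] [NormedSpace ℂ E]
    {f g : HilbertTensor H K →L[ℂ] E}
    (h : ∀ a b, f ((a ⊗ₜ[ℂ] b : H ⊗[ℂ] K) : HilbertTensor H K) =
      g ((a ⊗ₜ[ℂ] b : H ⊗[ℂ] K) : HilbertTensor H K)) : f = g := by
  ext z
  induction z using UniformSpace.Completion.induction_on with
  | hp => exact isClosed_eq f.continuous g.continuous
  | ih z =>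
    induction z using TensorProduct.induction_on with
    | zero => rw [UniformSpace.Completion.coe_zero, map_zero, map_zero]
    | tmul a b => exact h a b
    | add x y hx hy => simp only [UniformSpace.Completion.coe_add, map_add, hx, hy]

theorem opTensor_comp (S' : H' →L[ℂ] H'') (R' : K' →L[ℂ] K'') (S : H →L[ℂ] H') (R : K →L[ℂ] K') :
    (opTensor S' R').comp (opTensor S R) = opTensor (S'.comp S) (R'.comp R) := by
  refine opTensor_ext fun a b => ?_
  simp [opTensor_coe, ContinuousLinearMap.comp_apply]

theorem opTensor_one : opTensor (1 : H →L[ℂ] H) (1 : K →L[ℂ] K) = 1 := by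
  refine opTensor_ext fun a b => ?_
  simp [opTensor_coe]

theorem opTensor_add_left (S S' : H →L[ℂ] H') (R : K →L[ℂ] K') :
    opTensor (S + S') R = opTensor S R + opTensor S' R := by
  refine opTensor_ext fun a b => ?_
  simp [opTensor_coe, TensorProduct.add_tmul, UniformSpace.Completion.coe_add]

theorem opTensor_add_right (S : H →L[ℂ] H') (R R' : K →L[ℂ] K') :
    opTensor S (R + R') = opTensor S R + opTensor S R' := by
  refine opTensor_ext fun a b => ?_
  simp [opTensor_coe, TensorProduct.tmul_add, UniformSpace.Completion.coe_add]

theorem opTensor_smul_left (c : ℂ) (S : H →L[ℂ] H') (R : K →L[ℂ] K') :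
    opTensor (c • S) R = c • opTensor S R := by
  refine opTensor_ext fun a b => ?_
  rw [smul_apply, opTensor_coe, opTensor_coe,
    ← UniformSpace.Completion.coe_smul]
  rfl

theorem opTensor_smul_right (c : ℂ) (S : H →L[ℂ] H') (R : K →L[ℂ] K') :
    opTensor S (c • R) = c • opTensor S R := by
  refine opTensor_ext fun a b => ?_
  rw [smul_apply, opTensor_coe, opTensor_coe,
    ← UniformSpace.Completion.coe_smul]
  simp

theorem opTensor_adjoint [CompleteSpace H] [CompleteSpace H'] [CompleteSpace K] [CompleteSpace K']
    (S : H →L[ℂ] H') (R : K →L[ℂ] K') :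
    (opTensor S R).adjoint = opTensor S.adjoint R.adjoint := by
  symm
  rw [ContinuousLinearMap.eq_adjoint_iff]
  intro x y
  induction x, y using UniformSpace.Completion.induction_on₂ with
  | hp => exact isClosed_eq (by fun_prop) (by fun_prop)
  | ih x y =>
    simp only [opTensor_coe, UniformSpace.Completion.inner_coe]
    induction x using TensorProduct.induction_on with
    | zero => simp
    | add x x' hx hx' => simp only [map_add, inner_add_left, hx, hx']
    | tmul a b =>
      induction y using TensorProduct.induction_on with
      | zero => simp
      | add x x' hx hx' => simp only [map_add, inner_add_right, hx, hx']
      | tmul c d => simp [ContinuousLinearMap.adjoint_inner_left]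

theorem norm_opTensor_le (S : H →L[ℂ] H') (R : K →L[ℂ] K') :
    ‖opTensor S R‖ ≤ ‖S‖ * ‖R‖ := by
  refine ContinuousLinearMap.opNorm_le_bound _ (by positivity) fun z => ?_
  induction z using UniformSpace.Completion.induction_on with
  | hp => exact isClosed_le (by fun_prop) (by fun_prop)
  | ih z =>
    rw [opTensor, ContinuousLinearMap.completion_apply_coe, UniformSpace.Completion.norm_coe,
      UniformSpace.Completion.norm_coe]
    exact (ContinuousLinearMap.le_opNorm _ _).trans
      (mul_le_mul_of_nonneg_right (TensorProduct.norm_mapL_le S R) (norm_nonneg _))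

end HilbertTensor

/-- A unital `*`-representation of a C*-algebra on a nonzero Hilbert space. -/
structure UnitalRep (A : Type u) [CStarAlgebra A] where
  /-- the underlying Hilbert space -/
  H : Type u
  [normedAddCommGroup : NormedAddCommGroup H]
  [innerProductSpace : InnerProductSpace ℂ H]
  [completeSpace : CompleteSpace H]
  [nontrivial : Nontrivial H]
  /-- the representation -/
  π : A →⋆ₐ[ℂ] (H →L[ℂ] H)

attribute [instance] UnitalRep.normedAddCommGroup UnitalRep.innerProductSpace
  UnitalRep.completeSpace UnitalRep.nontrivial

section MinTensor

variable {A : Type u} {B : Type v} [CStarAlgebra A] [CStarAlgebra B]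

variable (A B) in
/-- The C*-algebra `B(H_π ⊗ H_ρ)`, for a pair `(π, ρ)` of representations. -/
def PairOp (p : UnitalRep A × UnitalRep B) : Type _ :=
  HilbertTensor p.1.H p.2.H →L[ℂ] HilbertTensor p.1.H p.2.H

theorem nontrivial_hilbertTensor (p : UnitalRep A × UnitalRep B) :
    Nontrivial (HilbertTensor p.1.H p.2.H) := by
  obtain ⟨x, hx⟩ := exists_ne (0 : p.1.H)
  obtain ⟨y, hy⟩ := exists_ne (0 : p.2.H)
  refine ⟨((x ⊗ₜ[ℂ] y : p.1.H ⊗[ℂ] p.2.H) : HilbertTensor p.1.H p.2.H), 0, fun h => ?_⟩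
  have h1 := congrArg norm h
  rw [UniformSpace.Completion.norm_coe, norm_zero, TensorProduct.norm_tmul] at h1
  simp [hx, hy] at h1

namespace PairOp

variable (p : UnitalRep A × UnitalRep B)

instance : CStarAlgebra (PairOp A B p) :=
  inferInstanceAs (CStarAlgebra (HilbertTensor p.1.H p.2.H →L[ℂ] HilbertTensor p.1.H p.2.H))

instance : Nontrivial (PairOp A B p) :=
  haveI := nontrivial_hilbertTensor p
  inferInstanceAs (Nontrivial (HilbertTensor p.1.H p.2.H →L[ℂ] HilbertTensor p.1.H p.2.H))

variable {p} in
/-- The operator `S ⊗ R` on `H_π ⊗ H_ρ` as an element of `PairOp`. -/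
def ofOp (S : p.1.H →L[ℂ] p.1.H) (R : p.2.H →L[ℂ] p.2.H) : PairOp A B p := opTensor S R

theorem ofOp_mul (S S' : p.1.H →L[ℂ] p.1.H) (R R' : p.2.H →L[ℂ] p.2.H) :
    (ofOp S R : PairOp A B p) * ofOp S' R' = ofOp (S * S') (R * R') :=
  opTensor_comp S R S' R'

theorem ofOp_one : (ofOp 1 1 : PairOp A B p) = 1 := opTensor_one

theorem ofOp_star (S : p.1.H →L[ℂ] p.1.H) (R : p.2.H →L[ℂ] p.2.H) :
    star (ofOp S R : PairOp A B p) = ofOp (star S) (star R) := opTensor_adjoint S R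

/-- The representation `x ↦ π(x) ⊗ 1`. -/
def left : A →ₐ[ℂ] PairOp A B p :=
  AlgHom.ofLinearMap
    { toFun := fun x => ofOp (p.1.π x) 1
      map_add' := fun x y => by rw [map_add]; exact opTensor_add_left _ _ _
      map_smul' := fun c x => by rw [map_smul]; exact opTensor_smul_left _ _ _ }
    (by
      change ofOp (p.1.π 1) 1 = 1
      rw [map_one, ofOp_one])
    (fun x y => by
      change ofOp (p.1.π (x * y)) 1 = ofOp (p.1.π x) 1 * ofOp (p.1.π y) 1
      rw [ofOp_mul, map_mul, mul_one])

/-- The representation `y ↦ 1 ⊗ ρ(y)`. -/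
def right : B →ₐ[ℂ] PairOp A B p :=
  AlgHom.ofLinearMap
    { toFun := fun y => ofOp 1 (p.2.π y)
      map_add' := fun x y => by rw [map_add]; exact opTensor_add_right _ _ _
      map_smul' := fun c x => by rw [map_smul]; exact opTensor_smul_right _ _ _ }
    (by
      change ofOp 1 (p.2.π 1) = 1
      rw [map_one, ofOp_one])
    (fun x y => by
      change ofOp 1 (p.2.π (x * y)) = ofOp 1 (p.2.π x) * ofOp 1 (p.2.π y)
      rw [ofOp_mul, map_mul, mul_one])

theorem left_mul_right (x : A) (y : B) : left p x * right p y = ofOp (p.1.π x) (p.2.π y) := by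
  change ofOp (p.1.π x) 1 * ofOp 1 (p.2.π y) = _
  rw [ofOp_mul, mul_one, one_mul]

theorem right_mul_left (x : A) (y : B) : right p y * left p x = ofOp (p.1.π x) (p.2.π y) := by
  change ofOp 1 (p.2.π y) * ofOp (p.1.π x) 1 = _
  rw [ofOp_mul, mul_one, one_mul]

/-- The tensor product representation `π ⊗ ρ` as an algebra homomorphism. -/
def repAlg : A ⊗[ℂ] B →ₐ[ℂ] PairOp A B p :=
  Algebra.TensorProduct.lift (left p) (right p)
    (fun x y => (left_mul_right p x y).trans (right_mul_left p x y).symm)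

theorem repAlg_tmul (x : A) (y : B) : repAlg p (x ⊗ₜ[ℂ] y) = ofOp (p.1.π x) (p.2.π y) :=
  (Algebra.TensorProduct.lift_tmul _ _ _ x y).trans (left_mul_right p x y)

/-- The tensor product representation `π ⊗ ρ` of the algebraic tensor product on `H_π ⊗ H_ρ`,
given by `(π ⊗ ρ)(x ⊗ y) = π(x) ⊗ ρ(y)`. -/
def rep : A ⊗[ℂ] B →⋆ₐ[ℂ] PairOp A B p :=
  { repAlg p with
    map_star' := fun z => by
      change repAlg p (star z) = star (repAlg p z)
      induction z using TensorProduct.induction_on with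
      | zero => rw [star_zero, map_zero, star_zero]
      | add x y hx hy => rw [star_add, map_add, hx, hy, map_add, star_add]
      | tmul a b =>
        rw [TensorProduct.star_tmul, repAlg_tmul, repAlg_tmul, ofOp_star, map_star, map_star] }

theorem rep_tmul (x : A) (y : B) : rep p (x ⊗ₜ[ℂ] y) = ofOp (p.1.π x) (p.2.π y) :=
  repAlg_tmul p x y

theorem norm_ofOp_le (S : p.1.H →L[ℂ] p.1.H) (R : p.2.H →L[ℂ] p.2.H) :
    ‖(ofOp S R : PairOp A B p)‖ ≤ ‖S‖ * ‖R‖ := norm_opTensor_le S R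

end PairOp

variable (A B) in
/-- The C*-algebra of bounded families of operators, the `ℓ^∞`-product of the algebras
`B(H_π ⊗ H_ρ)` over all pairs of representations, with the supremum norm. -/
abbrev PairProd : Type _ := lp (PairOp A B) ∞

instance : CStarAlgebra (PairProd A B) where

theorem memℓp_rep (z : A ⊗[ℂ] B) :
    Memℓp (fun p : UnitalRep A × UnitalRep B => PairOp.rep p z) ∞ := by
  induction z using TensorProduct.induction_on with
  | zero =>
    simp only [map_zero]
    exact (zero_memℓp : Memℓp (0 : ∀ p, PairOp A B p) ∞)
  | add x y hx hy =>
    simp only [map_add]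
    exact hx.add hy
  | tmul a b =>
    refine memℓp_infty ⟨‖a‖ * ‖b‖, ?_⟩
    rintro _ ⟨p, rfl⟩
    change ‖PairOp.rep p (a ⊗ₜ[ℂ] b)‖ ≤ ‖a‖ * ‖b‖
    rw [PairOp.rep_tmul]
    exact (PairOp.norm_ofOp_le _ _ _).trans (mul_le_mul (NonUnitalStarAlgHom.norm_apply_le _ _)
      (NonUnitalStarAlgHom.norm_apply_le _ _) (norm_nonneg _) (norm_nonneg _))

variable (A B) in
/-- The canonical map of the algebraic tensor product into the product of all the
`B(H_π ⊗ H_ρ)`. The induced norm `‖z‖ = sup ‖(π ⊗ ρ)(z)‖` is the minimal C*-norm. -/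
def toPairProd : A ⊗[ℂ] B →⋆ₐ[ℂ] PairProd A B where
  toFun z := ⟨fun p => PairOp.rep p z, memℓp_rep z⟩
  map_one' := by ext1; funext p; exact map_one (PairOp.rep p)
  map_mul' x y := by ext1; funext p; exact map_mul (PairOp.rep p) x y
  map_zero' := by ext1; funext p; exact map_zero (PairOp.rep p)
  map_add' x y := by ext1; funext p; exact map_add (PairOp.rep p) x y
  commutes' c := by ext1; funext p; exact (PairOp.rep p).commutes' c
  map_star' x := by ext1; funext p; exact map_star (PairOp.rep p) x

variable (A B) in
/-- The minimal C*-tensor product `A ⊗ B`: the completion of the algebraic tensor product in the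
norm `‖z‖ = sup ‖(π ⊗ ρ)(z)‖`, realised as a closed `*`-subalgebra. -/
def MinTensor : Type _ := (toPairProd A B).range.topologicalClosure

namespace MinTensor

instance : IsClosed ((toPairProd A B).range.topologicalClosure : Set (PairProd A B)) :=
  StarSubalgebra.isClosed_topologicalClosure _

instance : CStarAlgebra (MinTensor A B) :=
  inferInstanceAs (CStarAlgebra (toPairProd A B).range.topologicalClosure)

instance : PartialOrder (MinTensor A B) := CStarAlgebra.spectralOrder _

instance : StarOrderedRing (MinTensor A B) := CStarAlgebra.spectralOrderedRing _

variable (A B) in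
/-- The inclusion of the algebraic tensor product. -/
def ofAlg : A ⊗[ℂ] B →⋆ₐ[ℂ] MinTensor A B :=
  (StarSubalgebra.inclusion (StarSubalgebra.le_topologicalClosure _)).comp
    (toPairProd A B).rangeRestrict

/-- The elementary tensor `x ⊗ y`. -/
def tmul (x : A) (y : B) : MinTensor A B := ofAlg A B (x ⊗ₜ[ℂ] y)

/-- The representation of the minimal tensor product extending `π ⊗ ρ`. -/
def eval (p : UnitalRep A × UnitalRep B) : MinTensor A B →⋆ₐ[ℂ] PairOp A B p where
  toFun z := z.1 p
  map_one' := rfl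
  map_mul' _ _ := rfl
  map_zero' := rfl
  map_add' _ _ := rfl
  commutes' _ := rfl
  map_star' _ := rfl

theorem eval_ofAlg (p : UnitalRep A × UnitalRep B) (z : A ⊗[ℂ] B) :
    eval p (ofAlg A B z) = PairOp.rep p z := rfl

theorem eval_tmul (p : UnitalRep A × UnitalRep B) (x : A) (y : B) :
    eval p (tmul x y) = PairOp.ofOp (p.1.π x) (p.2.π y) := PairOp.rep_tmul p x y

theorem ext_eval {x y : MinTensor A B} (h : ∀ p, eval p x = eval p y) : x = y :=
  Subtype.ext (lp.ext (funext h))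

/-- The norm of the minimal tensor product on the algebraic tensor product is
`‖z‖ = sup ‖(π ⊗ ρ)(z)‖`, over all pairs of representations. -/
theorem norm_ofAlg (z : A ⊗[ℂ] B) :
    ‖ofAlg A B z‖ = ⨆ p : UnitalRep A × UnitalRep B, ‖PairOp.rep p z‖ :=
  lp.norm_eq_ciSup (toPairProd A B z)

theorem denseRange_ofAlg : DenseRange (ofAlg A B) := by
  intro z
  have h : z.1 ∈ closure (Set.range (toPairProd A B)) := z.2
  refine closure_subtype.2 ?_
  convert! h using 1
  congr 1
  ext w
  constructor
  · rintro ⟨_, ⟨a, rfl⟩, rfl⟩; exact ⟨a, rfl⟩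
  · rintro ⟨a, rfl⟩; exact ⟨ofAlg A B a, ⟨a, rfl⟩, rfl⟩

end MinTensor
end MinTensor

section Gram

theorem exists_eq_star_mul_self {E : Type*} [CStarAlgebra E] [PartialOrder E] [StarOrderedRing E]
    {x : E} (hx : 0 ≤ x) : ∃ R, x = star R * R :=
  CStarAlgebra.nonneg_iff_eq_star_mul_self.mp hx

theorem exists_cube {E : Type*} [CStarAlgebra E] [PartialOrder E] [StarOrderedRing E]
    {x : E} (hx : IsSelfAdjoint x) :
    ∃ N R : E, star N * x * N = -(star R * R) ∧ (R = 0 → 0 ≤ x) := by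
  have hN0 : 0 ≤ x⁻ := CFC.negPart_nonneg x
  have hNs : star x⁻ = x⁻ := hN0.isSelfAdjoint
  have hcube : 0 ≤ star x⁻ * x⁻ * x⁻ := star_left_conjugate_nonneg hN0 _
  obtain ⟨R, hR⟩ := exists_eq_star_mul_self hcube
  refine ⟨x⁻, R, ?_, fun h => ?_⟩
  · rw [← hR]
    have h1 : x⁻ * x⁺ = 0 := CFC.negPart_mul_posPart x
    have h2 : x⁻ * x = -(x⁻ * x⁻) := by
      rw [← zero_sub, ← h1, ← mul_sub, CFC.posPart_sub_negPart x hx]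
    rw [hNs, h2, neg_mul]
  · rw [← CFC.negPart_eq_zero_iff x hx]
    rw [h, mul_zero, hNs] at hR
    have h2 : x⁻ * x⁻ = 0 := by
      rw [← CStarRing.star_mul_self_eq_zero_iff, star_mul, hNs, ← mul_assoc, hR, zero_mul]
    rw [← CStarRing.star_mul_self_eq_zero_iff, hNs, h2]

variable {D : Type*} [CStarAlgebra D] [PartialOrder D] [StarOrderedRing D]
  {K : Type*} [NormedAddCommGroup K] [InnerProductSpace ℂ K] [CompleteSpace K]
  {ι : Type*} [Fintype ι] [DecidableEq ι]

theorem gram_conj (θ : D →⋆ₐ[ℂ] (K →L[ℂ] K)) (M R : CStarMatrix ι ι D) (ξ : ι → K) :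
    ∑ i, ∑ j, ⟪ξ i, θ ((star R * M * R) i j) (ξ j)⟫_ℂ =
      ∑ i, ∑ j, ⟪∑ k, θ (R i k) (ξ k), θ (M i j) (∑ k, θ (R j k) (ξ k))⟫_ℂ := by
  have h1 : ∀ i j, ⟪ξ i, θ ((star R * M * R) i j) (ξ j)⟫_ℂ =
      ∑ l, ∑ k, ⟪θ (R k i) (ξ i), θ (M k l) (θ (R l j) (ξ j))⟫_ℂ := by
    intro i j
    simp only [CStarMatrix.mul_apply, CStarMatrix.star_apply, map_sum, map_mul, map_star,
      Finset.sum_mul, sum_apply, mul_apply_eq_comp, inner_sum,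
      ContinuousLinearMap.star_eq_adjoint, ContinuousLinearMap.adjoint_inner_right]
  have h2 : ∀ k l, ⟪∑ i, θ (R k i) (ξ i), θ (M k l) (∑ j, θ (R l j) (ξ j))⟫_ℂ =
      ∑ i, ∑ j, ⟪θ (R k i) (ξ i), θ (M k l) (θ (R l j) (ξ j))⟫_ℂ := by
    intro k l
    rw [map_sum, sum_inner]
    simp only [inner_sum]
  have h3 : ∀ F : ι → ι → ι → ι → ℂ,
      ∑ i, ∑ j, ∑ l, ∑ k, F i j k l = ∑ k, ∑ l, ∑ i, ∑ j, F i j k l := fun F => calc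
    _ = ∑ i, ∑ l, ∑ j, ∑ k, F i j k l := Finset.sum_congr rfl fun _ _ => Finset.sum_comm
    _ = ∑ i, ∑ l, ∑ k, ∑ j, F i j k l :=
      Finset.sum_congr rfl fun _ _ => Finset.sum_congr rfl fun _ _ => Finset.sum_comm
    _ = ∑ i, ∑ k, ∑ l, ∑ j, F i j k l := Finset.sum_congr rfl fun _ _ => Finset.sum_comm
    _ = ∑ k, ∑ i, ∑ l, ∑ j, F i j k l := Finset.sum_comm
    _ = _ := Finset.sum_congr rfl fun _ _ => Finset.sum_comm
  simp only [h1, h2]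
  exact h3 fun i j k l => ⟪θ (R k i) (ξ i), θ (M k l) (θ (R l j) (ξ j))⟫_ℂ

theorem gram_star_mul_self (θ : D →⋆ₐ[ℂ] (K →L[ℂ] K)) (R : CStarMatrix ι ι D) (ξ : ι → K) :
    ∑ i, ∑ j, ⟪ξ i, θ ((star R * R) i j) (ξ j)⟫_ℂ =
      ∑ k, ((‖∑ j, θ (R k j) (ξ j)‖ ^ 2 : ℝ) : ℂ) := by
  have h := gram_conj θ 1 R ξ
  rw [mul_one] at h
  rw [h]
  refine Finset.sum_congr rfl fun i _ => ?_
  rw [Finset.sum_eq_single i]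
  · rw [CStarMatrix.one_apply_eq, map_one, one_apply_eq_self,
      inner_self_eq_norm_sq_to_K]
    norm_cast
  · intro j _ hj
    rw [CStarMatrix.one_apply_ne hj.symm, map_zero, zero_apply, inner_zero_right]
  · simp

theorem gram_nonneg (θ : D →⋆ₐ[ℂ] (K →L[ℂ] K)) {M : CStarMatrix ι ι D} (hM : 0 ≤ M)
    (ξ : ι → K) : 0 ≤ ∑ i, ∑ j, ⟪ξ i, θ (M i j) (ξ j)⟫_ℂ := by
  obtain ⟨R, rfl⟩ := exists_eq_star_mul_self hM
  rw [gram_star_mul_self]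
  exact Finset.sum_nonneg fun k _ => by
    rw [Complex.zero_le_real]; positivity

/-- A self-adjoint matrix over a C*-algebra is positive as soon as it is positive in every member
of a separating family of representations. -/
theorem nonneg_of_gram_nonneg {P : Type*} {L : P → Type*} [∀ p, NormedAddCommGroup (L p)]
    [∀ p, InnerProductSpace ℂ (L p)] [∀ p, CompleteSpace (L p)]
    (θ : ∀ p, D →⋆ₐ[ℂ] (L p →L[ℂ] L p)) (hθ : ∀ x, (∀ p, θ p x = 0) → x = 0)
    (M : CStarMatrix ι ι D) (hM : IsSelfAdjoint M)
    (h : ∀ p (ξ : ι → L p), 0 ≤ ∑ i, ∑ j, ⟪ξ i, θ p (M i j) (ξ j)⟫_ℂ) : 0 ≤ M := by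
  obtain ⟨N, R, hNR, hR⟩ := exists_cube hM
  refine hR ?_
  ext k j
  refine hθ _ fun p => ?_
  ext ζ
  have h1 := h p (fun i => ∑ k, θ p (N i k) (Pi.single (M := fun _ => L p) j ζ k))
  rw [← gram_conj, hNR] at h1
  simp only [CStarMatrix.neg_apply, map_neg, neg_apply, inner_neg_right, Finset.sum_neg_distrib]
    at h1
  rw [gram_star_mul_self, Left.nonneg_neg_iff, ← Complex.ofReal_sum, ← Complex.ofReal_zero,
    Complex.real_le_real] at h1
  have h2 := (Finset.sum_eq_zero_iff_of_nonneg (fun i _ => by positivity)).mp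
    (le_antisymm h1 (Finset.sum_nonneg fun i _ => by positivity)) k (Finset.mem_univ k)
  rw [sq_eq_zero_iff, norm_eq_zero, Finset.sum_eq_single j] at h2
  · simpa using h2
  · intro l _ hl
    rw [Pi.single_eq_of_ne hl, map_zero]
  · simp

end Gram

section Stinespring

variable {A : Type u} [CStarAlgebra A] [PartialOrder A] [StarOrderedRing A]

/-- The sesquilinear form `⟨a ⊗ ξ, b ⊗ η⟩ = ⟨ξ, π(T(a* b)) η⟩` on `A ⊙ H`. -/
def dilForm (T : A →CP A) (π : UnitalRep A) : A ⊗[ℂ] π.H →ₗ⋆[ℂ] A ⊗[ℂ] π.H →ₗ[ℂ] ℂ :=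
  TensorProduct.lift <| LinearMap.mk₂'ₛₗ (starRingEnd ℂ) (starRingEnd ℂ)
    (fun (a : A) (ξ : π.H) => TensorProduct.lift <| LinearMap.mk₂ ℂ
      (fun (b : A) (η : π.H) => ⟪ξ, π.π (T (star a * b)) η⟫_ℂ)
      (fun b b' η => by simp [mul_add])
      (fun c b η => by simp)
      (fun b η η' => by simp)
      (fun c b η => by simp))
    (fun a a' ξ => by ext; simp [add_mul])
    (fun c a ξ => by ext; simp)
    (fun a ξ ξ' => by ext; simp)
    (fun c a ξ => by ext; simp [mul_comm])

theorem dilForm_tmul (T : A →CP A) (π : UnitalRep A) (a b : A) (ξ η : π.H) :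
    dilForm T π (a ⊗ₜ ξ) (b ⊗ₜ η) = ⟪ξ, π.π (T (star a * b)) η⟫_ℂ := rfl

theorem map_star_of_cp {A B : Type*} [CStarAlgebra A] [PartialOrder A] [StarOrderedRing A]
    [CStarAlgebra B] [PartialOrder B] [StarOrderedRing B] (T : A →CP B) (a : A) :
    T (star a) = star (T a) := map_star T a

theorem dilForm_conj_symm (T : A →CP A) (π : UnitalRep A) (x y : A ⊗[ℂ] π.H) :
    starRingEnd ℂ (dilForm T π y x) = dilForm T π x y := by
  induction x using TensorProduct.induction_on with
  | zero => simp
  | add x x' hx hx' => simp only [map_add, LinearMap.add_apply, hx, hx']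
  | tmul a ξ =>
    induction y using TensorProduct.induction_on with
    | zero => simp
    | add x x' hx hx' => simp only [map_add, LinearMap.add_apply, hx, hx']
    | tmul b η =>
      rw [dilForm_tmul, dilForm_tmul, inner_conj_symm, ← ContinuousLinearMap.adjoint_inner_right,
        ← ContinuousLinearMap.star_eq_adjoint, ← map_star, ← map_star_of_cp, star_mul, star_star]

theorem dilForm_nonneg (T : A →CP A) (π : UnitalRep A) (x : A ⊗[ℂ] π.H) :
    0 ≤ dilForm T π x x := by
  obtain ⟨n, e, g, rfl⟩ := TensorProduct.exists_sum_tmul_eq x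
  simp only [map_sum, LinearMap.sum_apply, dilForm_tmul]
  rw [Finset.sum_comm]
  cases n with
  | zero => simp
  | succ n =>
    let N : CStarMatrix (Fin (n + 1)) (Fin (n + 1)) A := fun k j => if k = 0 then e j else 0
    have hN : ∀ i j, (star N * N) i j = star (e i) * e j := by
      intro i j
      rw [CStarMatrix.mul_apply, Finset.sum_eq_single 0]
      · rw [CStarMatrix.star_apply]; rfl
      · intro k _ hk
        simp [N, hk]
      · simp
    have h := gram_nonneg π.π (T.map_cstarMatrix_nonneg (star N * N) (star_mul_self_nonneg N)) g
    simpa only [CStarMatrix.map_apply, hN] using h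

variable (T : A →CP A) (π : UnitalRep A)

/-- Left multiplication by `c` on `A ⊙ H`. -/
def dilMul : A →ₐ[ℂ] Module.End ℂ (A ⊗[ℂ] π.H) :=
  AlgHom.ofLinearMap
    { toFun := fun c => (LinearMap.mulLeft ℂ c).rTensor π.H
      map_add' := fun c d => by
        refine TensorProduct.ext' fun a ξ => ?_
        change ((c + d) * a) ⊗ₜ[ℂ] ξ = (c * a) ⊗ₜ[ℂ] ξ + (d * a) ⊗ₜ[ℂ] ξ
        rw [add_mul, TensorProduct.add_tmul]
      map_smul' := fun c d => by
        refine TensorProduct.ext' fun a ξ => ?_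
        change ((c • d) * a) ⊗ₜ[ℂ] ξ = c • ((d * a) ⊗ₜ[ℂ] ξ)
        rw [smul_mul_assoc, TensorProduct.smul_tmul'] }
    (by
      refine TensorProduct.ext' fun a ξ => ?_
      change (1 * a) ⊗ₜ[ℂ] ξ = a ⊗ₜ[ℂ] ξ
      rw [one_mul])
    (fun c d => by
      refine TensorProduct.ext' fun a ξ => ?_
      change (c * d * a) ⊗ₜ[ℂ] ξ = (c * (d * a)) ⊗ₜ[ℂ] ξ
      rw [mul_assoc])

theorem dilMul_tmul (c a : A) (ξ : π.H) : dilMul π c (a ⊗ₜ[ℂ] ξ) = (c * a) ⊗ₜ[ℂ] ξ := rfl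

theorem dilForm_mul (c : A) (x y : A ⊗[ℂ] π.H) :
    dilForm T π (dilMul π c x) y = dilForm T π x (dilMul π (star c) y) := by
  induction x using TensorProduct.induction_on with
  | zero => simp
  | add x x' hx hx' => simp only [map_add, LinearMap.add_apply, hx, hx']
  | tmul a ξ =>
    induction y using TensorProduct.induction_on with
    | zero => simp
    | add x x' hx hx' => simp only [map_add, hx, hx']
    | tmul b η => rw [dilMul_tmul, dilMul_tmul, dilForm_tmul, dilForm_tmul, star_mul, mul_assoc]

theorem dilForm_mul_mul_le (c : A) (x : A ⊗[ℂ] π.H) :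
    (dilForm T π (dilMul π c x) (dilMul π c x)).re ≤ ‖c‖ ^ 2 * (dilForm T π x x).re := by
  have h1 : 0 ≤ algebraMap ℂ A ((‖c‖ ^ 2 : ℝ) : ℂ) - star c * c := by
    rw [sub_nonneg]
    refine CStarAlgebra.star_mul_le_algebraMap_norm_sq.trans (le_of_eq ?_)
    rw [IsScalarTower.algebraMap_apply ℝ ℂ A]; rfl
  obtain ⟨R, hR⟩ := exists_eq_star_mul_self h1
  have h2 : ∀ d : A, dilForm T π x (dilMul π (star d * d) x) =
      dilForm T π (dilMul π d x) (dilMul π d x) := by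
    intro d
    rw [map_mul, dilForm_mul]; rfl
  have h3 := (RCLike.nonneg_iff.mp (dilForm_nonneg T π (dilMul π R x))).1
  rw [← h2, ← hR, map_sub, LinearMap.sub_apply, map_sub, h2, AlgHom.commutes,
    Module.algebraMap_end_apply, map_smul, smul_eq_mul] at h3
  rw [map_sub, sub_nonneg] at h3
  refine h3.trans (le_of_eq ?_)
  exact Complex.re_ofReal_mul _ _

/-- `A ⊙ H` as a space with the positive semidefinite form `dilForm T π`. -/
def DilPre (_T : A →CP A) (π : UnitalRep A) : Type u := A ⊗[ℂ] π.H

instance : AddCommGroup (DilPre T π) := inferInstanceAs (AddCommGroup (A ⊗[ℂ] π.H))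
instance : Module ℂ (DilPre T π) := inferInstanceAs (Module ℂ (A ⊗[ℂ] π.H))

/-- The identity map `A ⊙ H → DilPre T π`. -/
def toDil : A ⊗[ℂ] π.H ≃ₗ[ℂ] DilPre T π := LinearEquiv.refl ℂ _

/-- The pre-inner product of `DilPre T π`. -/
abbrev dilCore : PreInnerProductSpace.Core ℂ (DilPre T π) where
  inner x y := dilForm T π ((toDil T π).symm x) ((toDil T π).symm y)
  conj_inner_symm x y := dilForm_conj_symm T π _ _
  re_inner_nonneg x := (RCLike.nonneg_iff.mp (dilForm_nonneg T π _)).1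
  add_left x y z := by rw [map_add, map_add]; rfl
  smul_left x y c := by rw [map_smul, LinearMap.map_smulₛₗ]; rfl

instance : SeminormedAddCommGroup (DilPre T π) :=
  InnerProductSpace.Core.toSeminormedAddCommGroup (c := dilCore T π)
instance : InnerProductSpace ℂ (DilPre T π) := InnerProductSpace.ofCore (dilCore T π)

theorem dil_inner (x y : A ⊗[ℂ] π.H) :
    ⟪toDil T π x, toDil T π y⟫_ℂ = dilForm T π x y := rfl

theorem dil_norm_sq (x : A ⊗[ℂ] π.H) : ‖toDil T π x‖ ^ 2 = (dilForm T π x x).re := by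
  rw [← dil_inner, ← inner_self_eq_norm_sq (𝕜 := ℂ)]; rfl

/-- Left multiplication by `c` as a bounded operator. -/
def dilOp (c : A) : DilPre T π →L[ℂ] DilPre T π :=
  ((toDil T π).toLinearMap ∘ₗ dilMul π c ∘ₗ (toDil T π).symm.toLinearMap).mkContinuous ‖c‖
    fun x => by
      obtain ⟨x, rfl⟩ := (toDil T π).surjective x
      refine (sq_le_sq₀ (norm_nonneg _) (by positivity)).1 ?_
      change ‖toDil T π (dilMul π c x)‖ ^ 2 ≤ _
      rw [mul_pow, dil_norm_sq, dil_norm_sq]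
      exact dilForm_mul_mul_le T π c x

theorem dilOp_apply (c : A) (x : A ⊗[ℂ] π.H) :
    dilOp T π c (toDil T π x) = toDil T π (dilMul π c x) := rfl

theorem dilOp_ext {f g : UniformSpace.Completion (DilPre T π) →L[ℂ]
    UniformSpace.Completion (DilPre T π)}
    (h : ∀ x, f ((toDil T π x : DilPre T π) : UniformSpace.Completion (DilPre T π)) =
      g ((toDil T π x : DilPre T π) : UniformSpace.Completion (DilPre T π))) : f = g := by
  ext z
  induction z using UniformSpace.Completion.induction_on with
  | hp => exact isClosed_eq f.continuous g.continuous
  | ih z => exact h ((toDil T π).symm z)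

/-- The dilation representation of `A` on the completion of `DilPre T π`. -/
def dilRep : A →⋆ₐ[ℂ] (UniformSpace.Completion (DilPre T π) →L[ℂ]
    UniformSpace.Completion (DilPre T π)) where
  toFun c := (dilOp T π c).completion
  map_one' := dilOp_ext T π fun x => by
    rw [ContinuousLinearMap.completion_apply_coe, dilOp_apply, map_one]; rfl
  map_mul' c d := dilOp_ext T π fun x => by
    rw [mul_apply_eq_comp]
    simp only [ContinuousLinearMap.completion_apply_coe, dilOp_apply, map_mul]; rfl
  map_zero' := dilOp_ext T π fun x => by
    rw [ContinuousLinearMap.completion_apply_coe, dilOp_apply, map_zero,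
      LinearMap.zero_apply, map_zero, UniformSpace.Completion.coe_zero]
    rfl
  map_add' c d := dilOp_ext T π fun x => by
    rw [add_apply]
    simp only [ContinuousLinearMap.completion_apply_coe, dilOp_apply, map_add,
      LinearMap.add_apply, UniformSpace.Completion.coe_add]
  commutes' c := dilOp_ext T π fun x => by
    rw [ContinuousLinearMap.completion_apply_coe, dilOp_apply, AlgHom.commutes,
      Module.algebraMap_end_apply, Algebra.algebraMap_eq_smul_one, map_smul, UniformSpace.Completion.coe_smul]
    rfl
  map_star' c := by
    rw [ContinuousLinearMap.star_eq_adjoint, ContinuousLinearMap.eq_adjoint_iff]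
    intro x y
    induction x, y using UniformSpace.Completion.induction_on₂ with
    | hp => exact isClosed_eq (by fun_prop) (by fun_prop)
    | ih x y =>
      obtain ⟨x, rfl⟩ := (toDil T π).surjective x
      obtain ⟨y, rfl⟩ := (toDil T π).surjective y
      rw [ContinuousLinearMap.completion_apply_coe, ContinuousLinearMap.completion_apply_coe,
        UniformSpace.Completion.inner_coe, UniformSpace.Completion.inner_coe, dilOp_apply,
        dilOp_apply, dil_inner, dil_inner, dilForm_mul, star_star]

theorem dilRep_coe (c : A) (x : A ⊗[ℂ] π.H) :
    dilRep T π c ((toDil T π x : DilPre T π) : UniformSpace.Completion (DilPre T π)) =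
      ((toDil T π (dilMul π c x) : DilPre T π) : UniformSpace.Completion (DilPre T π)) :=
  ContinuousLinearMap.completion_apply_coe _ _

/-- Stinespring dilation of a unital completely positive map, in a representation. -/
theorem exists_dilation (hT : T 1 = 1) : ∃ (σ : UnitalRep A) (V : π.H →L[ℂ] σ.H), ‖V‖ ≤ 1 ∧
    ∀ a, (V.adjoint.comp (σ.π a)).comp V = π.π (T a) := by
  let V₀ : π.H →ₗ[ℂ] UniformSpace.Completion (DilPre T π) :=
    { toFun := fun ξ =>
        ((toDil T π ((1 : A) ⊗ₜ[ℂ] ξ) : DilPre T π) : UniformSpace.Completion (DilPre T π))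
      map_add' := fun ξ η => by
        rw [TensorProduct.tmul_add, map_add, UniformSpace.Completion.coe_add]
      map_smul' := fun c ξ => by
        rw [TensorProduct.tmul_smul, map_smul, UniformSpace.Completion.coe_smul]; rfl }
  have hV₀ : ∀ ξ, ‖V₀ ξ‖ = ‖ξ‖ := by
    intro ξ
    change ‖((toDil T π ((1 : A) ⊗ₜ[ℂ] ξ) : DilPre T π) : UniformSpace.Completion (DilPre T π))‖ = _
    rw [UniformSpace.Completion.norm_coe, ← sq_eq_sq₀ (norm_nonneg _) (norm_nonneg _), dil_norm_sq,
      dilForm_tmul, star_one, one_mul, hT, map_one, one_apply_eq_self,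
      ← inner_self_eq_norm_sq (𝕜 := ℂ)]
    rfl
  let V := V₀.mkContinuous 1 fun ξ => by rw [hV₀, one_mul]
  have : Nontrivial (UniformSpace.Completion (DilPre T π)) := by
    obtain ⟨ξ, hξ⟩ := exists_ne (0 : π.H)
    refine ⟨V₀ ξ, 0, fun h => hξ ?_⟩
    rw [← norm_eq_zero, ← hV₀, h, norm_zero]
  refine ⟨⟨UniformSpace.Completion (DilPre T π), dilRep T π⟩, V,
    LinearMap.mkContinuous_norm_le _ zero_le_one _, fun a => ?_⟩
  ext ξ
  refine ext_inner_left ℂ fun η => ?_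
  rw [ContinuousLinearMap.comp_apply, ContinuousLinearMap.comp_apply,
    ContinuousLinearMap.adjoint_inner_right]
  change ⟪((toDil T π ((1 : A) ⊗ₜ[ℂ] η) : DilPre T π) : UniformSpace.Completion (DilPre T π)),
    dilRep T π a ((toDil T π ((1 : A) ⊗ₜ[ℂ] ξ) : DilPre T π) : UniformSpace.Completion (DilPre T π))⟫_ℂ = _
  rw [dilRep_coe, UniformSpace.Completion.inner_coe, dil_inner, dilMul_tmul, dilForm_tmul,
    star_one, one_mul, mul_one]

end Stinespring

section TensorMap

variable {A : Type u} {B : Type v} [CStarAlgebra A] [PartialOrder A] [StarOrderedRing A]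
  [CStarAlgebra B] [PartialOrder B] [StarOrderedRing B]

/-- The compression `x ↦ X* x X`. -/
def PairOp.conj {p q : UnitalRep A × UnitalRep B}
    (X : HilbertTensor p.1.H p.2.H →L[ℂ] HilbertTensor q.1.H q.2.H) :
    PairOp A B q →ₗ[ℂ] PairOp A B p :=
  let f : (HilbertTensor q.1.H q.2.H →L[ℂ] HilbertTensor q.1.H q.2.H) →ₗ[ℂ]
      (HilbertTensor p.1.H p.2.H →L[ℂ] HilbertTensor p.1.H p.2.H) :=
    { toFun := fun x => (X.adjoint.comp x).comp X
      map_add' := fun x y => by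
        rw [ContinuousLinearMap.comp_add, ContinuousLinearMap.add_comp]
      map_smul' := fun c x => by
        rw [ContinuousLinearMap.comp_smul, ContinuousLinearMap.smul_comp]; rfl }
  f

theorem PairOp.norm_conj_le {p q : UnitalRep A × UnitalRep B}
    (X : HilbertTensor p.1.H p.2.H →L[ℂ] HilbertTensor q.1.H q.2.H) (hX : ‖X‖ ≤ 1)
    (x : PairOp A B q) : ‖PairOp.conj X x‖ ≤ ‖x‖ := by
  have h (y : HilbertTensor q.1.H q.2.H →L[ℂ] HilbertTensor q.1.H q.2.H) :
      ‖(X.adjoint.comp y).comp X‖ ≤ ‖y‖ := by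
    have h1 : ‖X.adjoint‖ ≤ 1 := by rw [LinearIsometryEquiv.norm_map]; exact hX
    calc _ ≤ ‖X.adjoint.comp y‖ * ‖X‖ := ContinuousLinearMap.opNorm_comp_le _ _
      _ ≤ (‖X.adjoint‖ * ‖y‖) * ‖X‖ := by gcongr; exact ContinuousLinearMap.opNorm_comp_le _ _
      _ ≤ 1 * ‖y‖ * 1 := by gcongr
      _ = ‖y‖ := by ring
  exact h x

/-- The contraction `x ↦ (X_p* x_{s(p)} X_p)_p` of the product of the `B(H_π ⊗ H_ρ)`. -/
def conjMap (s : UnitalRep A × UnitalRep B → UnitalRep A × UnitalRep B)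
    (X : ∀ p : UnitalRep A × UnitalRep B,
      HilbertTensor p.1.H p.2.H →L[ℂ] HilbertTensor (s p).1.H (s p).2.H)
    (hX : ∀ p, ‖X p‖ ≤ 1) : PairProd A B →L[ℂ] PairProd A B :=
  have hb : ∀ (x : PairProd A B) p, ‖PairOp.conj (X p) (x (s p))‖ ≤ ‖x‖ := fun x p =>
    (PairOp.norm_conj_le _ (hX p) _).trans (lp.norm_apply_le_norm ENNReal.top_ne_zero x (s p))
  LinearMap.mkContinuous
    { toFun := fun x => ⟨fun p => PairOp.conj (X p) (x (s p)),
        memℓp_infty ⟨‖x‖, by rintro _ ⟨p, rfl⟩; exact hb x p⟩⟩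
      map_add' := fun x y => by
        ext1; funext p
        exact map_add (PairOp.conj (X p)) (x (s p)) (y (s p))
      map_smul' := fun c x => by
        ext1; funext p
        exact map_smul (PairOp.conj (X p)) c (x (s p)) } 1
    fun x => by
      rw [one_mul]
      exact lp.norm_le_of_forall_le (norm_nonneg _) (hb x)

/-- `MinTensor.eval` with values in the bounded operators. -/
def MinTensor.evalOp (p : UnitalRep A × UnitalRep B) : MinTensor A B →⋆ₐ[ℂ]
    (HilbertTensor p.1.H p.2.H →L[ℂ] HilbertTensor p.1.H p.2.H) := MinTensor.eval p

theorem MinTensor.ext_tmul {E : Type*} [TopologicalSpace E] [T2Space E] [AddCommMonoid E]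
    [Module ℂ E] {f g : MinTensor A B →ₗ[ℂ] E} (hf : Continuous f) (hg : Continuous g)
    (h : ∀ x y, f (MinTensor.tmul x y) = g (MinTensor.tmul x y)) : f = g := by
  refine DFunLike.coe_injective (MinTensor.denseRange_ofAlg.equalizer hf hg (funext fun z => ?_))
  induction z using TensorProduct.induction_on with
  | zero => simp
  | tmul x y => exact h x y
  | add x y hx hy =>
    simp only [Function.comp_apply, map_add] at hx hy ⊢
    rw [hx, hy]

theorem MinTensor.tmul_one_one : (MinTensor.tmul 1 1 : MinTensor A B) = 1 :=
  map_one (MinTensor.ofAlg A B)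

theorem star_eq_of_nonneg {E : Type*} [CStarAlgebra E] [PartialOrder E] [StarOrderedRing E]
    {x : E} (hx : 0 ≤ x) : star x = x :=
  hx.isSelfAdjoint

/-- A map that is a compression in every member of a separating family of representations is
completely positive. -/
theorem map_nonneg_of_compression {D : Type*} [CStarAlgebra D] [PartialOrder D] [StarOrderedRing D]
    {P : Type*} {L : P → Type*} [∀ p, NormedAddCommGroup (L p)]
    [∀ p, InnerProductSpace ℂ (L p)] [∀ p, CompleteSpace (L p)]
    (θ : ∀ p, D →⋆ₐ[ℂ] (L p →L[ℂ] L p)) (hθ : ∀ x, (∀ p, θ p x = 0) → x = 0)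
    (s : P → P) (X : ∀ p, L p →L[ℂ] L (s p)) (S : D →ₗ[ℂ] D)
    (hS : ∀ p z, θ p (S z) = ((X p).adjoint.comp (θ (s p) z)).comp (X p))
    (k : ℕ) (M : CStarMatrix (Fin k) (Fin k) D) (hM : 0 ≤ M) : 0 ≤ M.map S := by
  have hstar : ∀ z, S (star z) = star (S z) := by
    intro z
    rw [← sub_eq_zero]
    refine hθ _ fun p => ?_
    rw [map_sub, sub_eq_zero, map_star (θ p), hS, hS, map_star (θ (s p)),
      ContinuousLinearMap.star_eq_adjoint, ContinuousLinearMap.star_eq_adjoint,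
      ContinuousLinearMap.adjoint_comp, ContinuousLinearMap.adjoint_comp,
      ContinuousLinearMap.adjoint_adjoint, ContinuousLinearMap.comp_assoc]
  refine nonneg_of_gram_nonneg θ hθ _ ?_ fun p ξ => ?_
  · have hMs : star M = M := star_eq_of_nonneg hM
    refine CStarMatrix.ext fun i j => ?_
    rw [CStarMatrix.star_apply, CStarMatrix.map_apply, CStarMatrix.map_apply, ← hstar,
      ← CStarMatrix.star_apply, hMs]
  · have h := gram_nonneg (θ (s p)) hM (fun i => X p (ξ i))
    refine h.trans_eq (Finset.sum_congr rfl fun i _ => Finset.sum_congr rfl fun j _ => ?_)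
    rw [CStarMatrix.map_apply, hS, ContinuousLinearMap.comp_apply,
      ContinuousLinearMap.comp_apply, ContinuousLinearMap.adjoint_inner_right]

theorem conjMap_toPairProd (T : A →CP A) (H : B →CP B)
    (σ : UnitalRep A → UnitalRep A) (V : ∀ π : UnitalRep A, π.H →L[ℂ] (σ π).H)
    (hVT : ∀ π a, ((V π).adjoint.comp ((σ π).π a)).comp (V π) = π.π (T a))
    (τ : UnitalRep B → UnitalRep B) (W : ∀ ρ : UnitalRep B, ρ.H →L[ℂ] (τ ρ).H)
    (hWH : ∀ ρ b, ((W ρ).adjoint.comp ((τ ρ).π b)).comp (W ρ) = ρ.π (H b))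
    (hX : ∀ p : UnitalRep A × UnitalRep B, ‖opTensor (V p.1) (W p.2)‖ ≤ 1) (z : A ⊗[ℂ] B) :
    conjMap (fun p => (σ p.1, τ p.2)) (fun p => opTensor (V p.1) (W p.2)) hX (toPairProd A B z) =
      toPairProd A B (TensorProduct.map (T : A →ₗ[ℂ] A) (H : B →ₗ[ℂ] B) z) := by
  induction z using TensorProduct.induction_on with
  | zero => simp only [map_zero]
  | add x y hx hy => simp only [map_add, hx, hy]
  | tmul x y =>
    ext1; funext p
    change PairOp.conj (opTensor (V p.1) (W p.2)) (PairOp.rep (σ p.1, τ p.2) (x ⊗ₜ[ℂ] y)) =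
      PairOp.rep p ((T x) ⊗ₜ[ℂ] (H y))
    rw [PairOp.rep_tmul, PairOp.rep_tmul]
    change ((opTensor _ _).adjoint.comp (opTensor _ _)).comp (opTensor _ _) = opTensor _ _
    rw [opTensor_adjoint, opTensor_comp, opTensor_comp, hVT, hWH]

/-- The restriction of a bounded operator to the minimal tensor product. -/
def MinTensor.restrict (Φ : PairProd A B →L[ℂ] PairProd A B)
    (hΦ : ∀ w, Φ (toPairProd A B w) ∈ Set.range (toPairProd A B)) :
    MinTensor A B →ₗ[ℂ] MinTensor A B where
  toFun z := ⟨Φ z.1, map_mem_closure Φ.continuous z.2 (by rintro _ ⟨w, rfl⟩; exact hΦ w)⟩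
  map_add' x y := Subtype.ext (map_add Φ x.1 y.1)
  map_smul' c x := Subtype.ext (map_smul Φ c x.1)

theorem exists_tensorLinearMap (T : A →CP A) (H : B →CP B) (hT : T 1 = 1) (hH : H 1 = 1) :
    ∃ (s : UnitalRep A × UnitalRep B → UnitalRep A × UnitalRep B)
      (X : ∀ p : UnitalRep A × UnitalRep B,
        HilbertTensor p.1.H p.2.H →L[ℂ] HilbertTensor (s p).1.H (s p).2.H)
      (S : MinTensor A B →ₗ[ℂ] MinTensor A B),
      (∀ p z, MinTensor.evalOp p (S z) =
        ((X p).adjoint.comp (MinTensor.evalOp (s p) z)).comp (X p)) ∧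
      ∀ x y, S (MinTensor.tmul x y) = MinTensor.tmul (T x) (H y) := by
  choose σ V hV hVT using fun π : UnitalRep A => exists_dilation T π hT
  choose τ W hW hWH using fun ρ : UnitalRep B => exists_dilation H ρ hH
  have hX : ∀ p : UnitalRep A × UnitalRep B, ‖opTensor (V p.1) (W p.2)‖ ≤ 1 :=
    fun p => (norm_opTensor_le _ _).trans (mul_le_one₀ (hV _) (norm_nonneg _) (hW _))
  have hΦ := conjMap_toPairProd T H σ V hVT τ W hWH hX
  generalize hP : conjMap (fun p : UnitalRep A × UnitalRep B => (σ p.1, τ p.2))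
    (fun p => opTensor (V p.1) (W p.2)) hX = Φ at hΦ
  refine ⟨fun p => (σ p.1, τ p.2), fun p => opTensor (V p.1) (W p.2),
    MinTensor.restrict Φ fun w => ⟨_, (hΦ w).symm⟩, fun p z => ?_, fun x y => ?_⟩
  · subst hP
    rfl
  · exact Subtype.ext (hΦ (x ⊗ₜ[ℂ] y))

/-- For ucp maps `T` and `H` there is exactly one completely positive map of the minimal tensor
product with `x ⊗ y ↦ T x ⊗ H y`. -/
theorem existsUnique_tensorMap (T : A →CP A) (H : B →CP B) (hT : T 1 = 1) (hH : H 1 = 1) :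
    ∃! S : MinTensor A B →CP MinTensor A B,
      ∀ x y, S (MinTensor.tmul x y) = MinTensor.tmul (T x) (H y) := by
  obtain ⟨s, X, S, hS, hSt⟩ := exists_tensorLinearMap T H hT hH
  have hpos : ∀ (k : ℕ) (M : CStarMatrix (Fin k) (Fin k) (MinTensor A B)), 0 ≤ M →
      0 ≤ M.map S :=
    map_nonneg_of_compression (fun p => MinTensor.evalOp p)
      (fun x hx => MinTensor.ext_eval fun p => (hx p).trans (map_zero _).symm) s X S hS
  refine ⟨{ S with map_cstarMatrix_nonneg' := hpos }, hSt, fun R hR => ?_⟩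
  have hc := map_continuous (⟨S, hpos⟩ : MinTensor A B →CP MinTensor A B)
  have h : (R : MinTensor A B →ₗ[ℂ] MinTensor A B) = S :=
    MinTensor.ext_tmul (map_continuous R) hc fun x y => (hR x y).trans (hSt x y).symm
  exact DFunLike.ext _ _ fun z => LinearMap.congr_fun h z

theorem exists_gns (φ : A →ₚ[ℂ] ℂ) (hφ : φ 1 = 1) :
    ∃ (π : UnitalRep A) (Ω : π.H), ∀ a, ⟪Ω, π.π a Ω⟫_ℂ = φ a := by
  let Ω : φ.GNS := ((φ.toPreGNS 1 : φ.PreGNS) : φ.GNS)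
  have hΩ : ∀ a, ⟪Ω, φ.gnsStarAlgHom a Ω⟫_ℂ = φ a := by
    intro a
    change ⟪((φ.toPreGNS 1 : φ.PreGNS) : φ.GNS),
      φ.gnsNonUnitalStarAlgHom a ((φ.toPreGNS 1 : φ.PreGNS) : φ.GNS)⟫_ℂ = φ a
    rw [PositiveLinearMap.gnsNonUnitalStarAlgHom_apply_coe, UniformSpace.Completion.inner_coe,
      PositiveLinearMap.preGNS_inner_def]
    simp
  have : Nontrivial φ.GNS := by
    refine ⟨Ω, 0, fun h => ?_⟩
    have h1 := hΩ 1
    rw [h, hφ, inner_zero_left] at h1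
    exact zero_ne_one h1
  exact ⟨⟨φ.GNS, φ.gnsStarAlgHom⟩, Ω, hΩ⟩

/-- For states `φ` and `ψ` there is exactly one positive functional on the minimal tensor product
with `x ⊗ y ↦ φ(x) ψ(y)`. -/
theorem existsUnique_tensorState (φ : A →ₚ[ℂ] ℂ) (ψ : B →ₚ[ℂ] ℂ) (hφ : φ 1 = 1) (hψ : ψ 1 = 1) :
    ∃! ω : MinTensor A B →ₚ[ℂ] ℂ, ∀ x y, ω (MinTensor.tmul x y) = φ x * ψ y := by
  obtain ⟨π, ξ, hξ⟩ := exists_gns φ hφ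
  obtain ⟨ρ, η, hη⟩ := exists_gns ψ hψ
  let ζ : HilbertTensor π.H ρ.H := ((ξ ⊗ₜ[ℂ] η : π.H ⊗[ℂ] ρ.H) : HilbertTensor π.H ρ.H)
  let ω : MinTensor A B →ₗ[ℂ] ℂ :=
    { toFun := fun z => ⟪ζ, MinTensor.evalOp (π, ρ) z ζ⟫_ℂ
      map_add' := fun x y => by rw [map_add, add_apply, inner_add_right]
      map_smul' := fun c x => by rw [map_smul, smul_apply, inner_smul_right]; rfl }
  have hω : ∀ z, 0 ≤ z → 0 ≤ ω z := by
    intro z hz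
    obtain ⟨R, rfl⟩ := exists_eq_star_mul_self hz
    change 0 ≤ ⟪ζ, MinTensor.evalOp (π, ρ) (star R * R) ζ⟫_ℂ
    rw [map_mul, map_star, mul_apply_eq_comp, ContinuousLinearMap.star_eq_adjoint,
      ContinuousLinearMap.adjoint_inner_right, inner_self_eq_norm_sq_to_K]
    positivity
  let ω' : MinTensor A B →ₚ[ℂ] ℂ :=
    { ω with
      monotone' := fun x y hxy => by
        have := hω (y - x) (sub_nonneg.2 hxy)
        rw [map_sub] at this
        exact sub_nonneg.1 this }
  have hω' : ∀ x y, ω' (MinTensor.tmul x y) = φ x * ψ y := by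
    intro x y
    have h : MinTensor.evalOp (π, ρ) (MinTensor.tmul x y) = opTensor (π.π x) (ρ.π y) :=
      MinTensor.eval_tmul (π, ρ) x y
    change ⟪ζ, MinTensor.evalOp (π, ρ) (MinTensor.tmul x y) ζ⟫_ℂ = _
    rw [h, opTensor_coe, UniformSpace.Completion.inner_coe, TensorProduct.map_tmul,
      TensorProduct.inner_tmul, ← hξ, ← hη]
    rfl
  refine ⟨ω', hω', fun ω₁ h₁ => ?_⟩
  have h : (ω₁ : MinTensor A B →ₗ[ℂ] ℂ) = (ω' : MinTensor A B →ₗ[ℂ] ℂ) :=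
    MinTensor.ext_tmul (map_continuous ω₁) (map_continuous ω')
      fun x y => (h₁ x y).trans (hω' x y).symm
  exact DFunLike.ext _ _ fun z => LinearMap.congr_fun h z

end TensorMap

section Systems

variable {A : Type u} {B : Type v} [CStarAlgebra A] [PartialOrder A] [StarOrderedRing A]
  [CStarAlgebra B] [PartialOrder B] [StarOrderedRing B]

/-- A state preserving C*-dynamical system: a state `φ` on a unital C*-algebra together with a
unital completely positive map `T` such that `φ ∘ T = φ`. -/
structure StateSystem (A : Type u) [CStarAlgebra A] [PartialOrder A] [StarOrderedRing A] where
  /-- the invariant state -/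
  state : A →ₚ[ℂ] ℂ
  state_one : state 1 = 1
  /-- the unital completely positive map -/
  map : A →CP A
  map_one : map 1 = 1
  state_map : ∀ x, state (map x) = state x

/-- Strict weak mixing: the averages of `|ψ(T^k x) - ψ(1) φ(x)|` over `0 ≤ k < n` tend to `0`, for
every `x` in the algebra and every bounded linear functional `ψ`. -/
def StateSystem.IsStrictlyWeakMixing (S : StateSystem A) : Prop :=
  ∀ (x : A) (ψ : StrongDual ℂ A),
    Filter.Tendsto
      (fun n : ℕ => (1 / (n : ℝ)) *
        ∑ k ∈ Finset.range n, ‖ψ (S.map^[k] x) - ψ 1 * S.state x‖)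
      Filter.atTop (nhds 0)

/-- The map `T ⊗ H` on the minimal tensor product. -/
def StateSystem.tensorMap (S : StateSystem A) (R : StateSystem B) :
    MinTensor A B →CP MinTensor A B :=
  (existsUnique_tensorMap S.map R.map S.map_one R.map_one).choose

theorem StateSystem.tensorMap_tmul (S : StateSystem A) (R : StateSystem B) (x : A) (y : B) :
    S.tensorMap R (MinTensor.tmul x y) = MinTensor.tmul (S.map x) (R.map y) :=
  (existsUnique_tensorMap S.map R.map S.map_one R.map_one).choose_spec.1 x y

/-- The state `φ ⊗ φ₁` on the minimal tensor product. -/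
def StateSystem.tensorState (S : StateSystem A) (R : StateSystem B) : MinTensor A B →ₚ[ℂ] ℂ :=
  (existsUnique_tensorState S.state R.state S.state_one R.state_one).choose

theorem StateSystem.tensorState_tmul (S : StateSystem A) (R : StateSystem B) (x : A) (y : B) :
    S.tensorState R (MinTensor.tmul x y) = S.state x * R.state y :=
  (existsUnique_tensorState S.state R.state S.state_one R.state_one).choose_spec.1 x y

/-- The tensor product system `(A ⊗ B, φ ⊗ φ₁, T ⊗ H)` on the minimal C*-tensor product. -/
def StateSystem.tensor (S : StateSystem A) (R : StateSystem B) : StateSystem (MinTensor A B) where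
  state := S.tensorState R
  state_one := by
    rw [← MinTensor.tmul_one_one, S.tensorState_tmul, S.state_one, R.state_one, one_mul]
  map := S.tensorMap R
  map_one := by
    rw [← MinTensor.tmul_one_one, S.tensorMap_tmul, S.map_one, R.map_one]
  state_map x := by
    have h : (S.tensorState R : MinTensor A B →ₗ[ℂ] ℂ) ∘ₗ
        (S.tensorMap R : MinTensor A B →ₗ[ℂ] MinTensor A B) =
        (S.tensorState R : MinTensor A B →ₗ[ℂ] ℂ) :=
      MinTensor.ext_tmul ((map_continuous (S.tensorState R)).comp (map_continuous (S.tensorMap R)))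
        (map_continuous (S.tensorState R)) fun x y => by
          change S.tensorState R (S.tensorMap R (MinTensor.tmul x y)) = S.tensorState R _
          rw [S.tensorMap_tmul, S.tensorState_tmul, S.tensorState_tmul, S.state_map, R.state_map]
    exact LinearMap.congr_fun h x

variable (A B) in
/-- `A* ⊗ B*`: the norm closure in `(A ⊗ B)*` of the linear span of the product functionals
`ψ ⊗ φ` with `ψ ∈ A*` and `φ ∈ B*`. Here `ψ ⊗ φ` is the bounded functional determined by
`(ψ ⊗ φ)(x ⊗ y) = ψ(x) φ(y)`. -/
def dualTensor : Submodule ℂ (StrongDual ℂ (MinTensor A B)) :=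
  (Submodule.span ℂ {ω | ∃ (ψ : StrongDual ℂ A) (φ : StrongDual ℂ B),
    ∀ x y, ω (MinTensor.tmul x y) = ψ x * φ y}).topologicalClosure

end Systems

end

end CStarMixing

/-!
Both directions rest on elementary functional analysis around the map `T ⊗ H`.

From the tensor product to the factors: `x ↦ x ⊗ 1` embeds the first system, dynamics and state
included, into the tensor product system. It is injective because states separate the points of a
C*-algebra (Hahn–Banach applied to the closed positive cone, `exists_state_apply_ne_zero`) and
every state of the factor is the restriction of a product state. An injective `*`-homomorphism is
isometric, so every bounded functional on the factor extends to the tensor product, and mixing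
restricts (`StateSystem.IsStrictlyWeakMixing.of_injective`). The second factor is treated alike.

From the factors to the tensor product: for a product functional `ψ ⊗ φ` and an elementary tensor
`x ⊗ y`, the values `ψ(T^k x) φ(H^k y)` are products of two bounded sequences that converge in
absolute Cesàro mean, so they converge in the same sense. The powers of a unital positive map are
uniformly bounded (`StateSystem.norm_iterate_map_le`), and therefore the set of elements, and
likewise the set of functionals, for which the averages tend to zero is a closed subspace
(`isClosed_cesaroNull`). Density of the algebraic tensor product extends the convergence to all
elements, and the hypothesis on the dual extends it to all functionals.
-/

namespace CStarMixing

universe u v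

noncomputable section

/-! ### Cesàro-null vectors -/

section Cesaro

variable {E : Type*} [NormedAddCommGroup E] [NormedSpace ℂ E]

/-- The vectors `x` along which the sequence of functionals `d k` tends to zero in absolute
Cesàro mean. -/
def cesaroNull (d : ℕ → E →ₗ[ℂ] ℂ) : Submodule ℂ E where
  carrier := {x | Filter.Tendsto (fun n : ℕ => (1 / (n : ℝ)) * ∑ k ∈ Finset.range n, ‖d k x‖)
    Filter.atTop (nhds 0)}
  zero_mem' := by simp
  add_mem' {x y} hx hy := by
    have h := Filter.Tendsto.add hx hy
    rw [add_zero] at h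
    refine squeeze_zero (fun n => by positivity) (fun n => ?_) h
    rw [← mul_add, ← Finset.sum_add_distrib]
    gcongr with k
    rw [map_add]
    exact norm_add_le _ _
  smul_mem' c x hx := by
    have h := Filter.Tendsto.const_mul ‖c‖ hx
    rw [mul_zero] at h
    refine h.congr fun n => ?_
    simp only [map_smul, norm_smul, ← Finset.mul_sum]
    ring

theorem mem_cesaroNull {d : ℕ → E →ₗ[ℂ] ℂ} {x : E} : x ∈ cesaroNull d ↔
    Filter.Tendsto (fun n : ℕ => (1 / (n : ℝ)) * ∑ k ∈ Finset.range n, ‖d k x‖)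
      Filter.atTop (nhds 0) := Iff.rfl

/-- Uniform boundedness of the `d k` allows approximation inside the Cesàro means. -/
theorem isClosed_cesaroNull {d : ℕ → E →ₗ[ℂ] ℂ} {C : ℝ} (hd : ∀ k x, ‖d k x‖ ≤ C * ‖x‖) :
    IsClosed (cesaroNull d : Set E) := by
  have hC : ∀ k x, ‖d k x‖ ≤ |C| * ‖x‖ := fun k x =>
    (hd k x).trans (mul_le_mul_of_nonneg_right (le_abs_self C) (norm_nonneg x))
  refine isClosed_of_closure_subset fun x hx => ?_
  rw [SetLike.mem_coe, mem_cesaroNull, Metric.tendsto_atTop]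
  intro ε hε
  obtain ⟨y, hy, hxy⟩ := Metric.mem_closure_iff.1 hx (ε / 2 / (|C| + 1)) (by positivity)
  obtain ⟨N, hN⟩ := Metric.tendsto_atTop.1 (mem_cesaroNull.1 hy) (ε / 2) (by positivity)
  refine ⟨N, fun n hn => ?_⟩
  have hy' := hN n hn
  rw [Real.dist_0_eq_abs, abs_of_nonneg (by positivity)] at hy' ⊢
  rw [dist_eq_norm, lt_div_iff₀ (by positivity)] at hxy
  have hterm : ∀ k, ‖d k x‖ ≤ ‖d k y‖ + |C| * ‖x - y‖ := fun k => by
    have h := norm_add_le (d k y) (d k (x - y))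
    rw [← map_add, add_sub_cancel] at h
    exact h.trans (by gcongr; exact hC k _)
  have havg : (1 / (n : ℝ)) * (n * (|C| * ‖x - y‖)) ≤ |C| * ‖x - y‖ := by
    rcases eq_or_ne n 0 with rfl | hn0
    · simp only [Nat.cast_zero, zero_mul, mul_zero]; positivity
    · have : (n : ℝ) ≠ 0 := Nat.cast_ne_zero.2 hn0
      field_simp
      exact le_rfl
  calc (1 / (n : ℝ)) * ∑ k ∈ Finset.range n, ‖d k x‖
      ≤ (1 / (n : ℝ)) * ∑ k ∈ Finset.range n, (‖d k y‖ + |C| * ‖x - y‖) := by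
        gcongr with k; exact hterm k
    _ = (1 / (n : ℝ)) * ∑ k ∈ Finset.range n, ‖d k y‖ + (1 / (n : ℝ)) * (n * (|C| * ‖x - y‖)) := by
        rw [Finset.sum_add_distrib, mul_add, Finset.sum_const, Finset.card_range, nsmul_eq_mul]
    _ < ε := by nlinarith [norm_nonneg (x - y)]

/-- Absolute Cesàro convergence passes to products when one of the sequences is bounded. -/
theorem tendsto_cesaro_norm_mul {a b : ℕ → ℂ} {α β : ℂ} {M : ℝ} (hM : ∀ k, ‖b k‖ ≤ M)
    (ha : Filter.Tendsto (fun n : ℕ => (1 / (n : ℝ)) * ∑ k ∈ Finset.range n, ‖a k - α‖)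
      Filter.atTop (nhds 0))
    (hb : Filter.Tendsto (fun n : ℕ => (1 / (n : ℝ)) * ∑ k ∈ Finset.range n, ‖b k - β‖)
      Filter.atTop (nhds 0)) :
    Filter.Tendsto (fun n : ℕ => (1 / (n : ℝ)) * ∑ k ∈ Finset.range n, ‖a k * b k - α * β‖)
      Filter.atTop (nhds 0) := by
  have h := (ha.const_mul M).add (hb.const_mul ‖α‖)
  rw [mul_zero, mul_zero, add_zero] at h
  refine squeeze_zero (fun n => by positivity) (fun n => ?_) h
  have hterm : ∀ k, ‖a k * b k - α * β‖ ≤ M * ‖a k - α‖ + ‖α‖ * ‖b k - β‖ := fun k => by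
    calc ‖a k * b k - α * β‖ = ‖b k * (a k - α) + α * (b k - β)‖ := by ring_nf
      _ ≤ ‖b k‖ * ‖a k - α‖ + ‖α‖ * ‖b k - β‖ :=
        (norm_add_le _ _).trans_eq (by rw [norm_mul, norm_mul])
      _ ≤ _ := by gcongr; exact hM k
  calc (1 / (n : ℝ)) * ∑ k ∈ Finset.range n, ‖a k * b k - α * β‖
      ≤ (1 / (n : ℝ)) * ∑ k ∈ Finset.range n, (M * ‖a k - α‖ + ‖α‖ * ‖b k - β‖) := by
        gcongr with k; exact hterm k
    _ = _ := by rw [Finset.sum_add_distrib, ← Finset.mul_sum, ← Finset.mul_sum]; ring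

end Cesaro

/-! ### Power boundedness -/

namespace StateSystem

variable {A : Type u} [CStarAlgebra A] [PartialOrder A] [StarOrderedRing A]

theorem iterate_map_nonneg (S : StateSystem A) {x : A} (hx : 0 ≤ x) (k : ℕ) :
    0 ≤ S.map^[k] x := by
  induction k with
  | zero => exact hx
  | succ k ih =>
    rw [Function.iterate_succ_apply']
    exact map_nonneg S.map ih

theorem norm_iterate_map_le_of_nonneg (S : StateSystem A) {x : A} (hx : 0 ≤ x) (k : ℕ) :
    ‖S.map^[k] x‖ ≤ ‖x‖ := by
  have : Nontrivial A := ⟨1, 0, fun h => by simpa [h] using S.state_one⟩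
  induction k with
  | zero => exact le_rfl
  | succ k ih =>
    rw [Function.iterate_succ_apply']
    have h := (PositiveLinearMap.ofClass (R := ℂ) S.map).norm_apply_le_of_nonneg _
      (S.iterate_map_nonneg hx k)
    have h1 : PositiveLinearMap.ofClass (R := ℂ) S.map 1 = 1 := S.map_one
    rw [h1, CStarRing.norm_one, one_mul] at h
    exact h.trans ih

theorem iterate_map_eq_pow (S : StateSystem A) (k : ℕ) (x : A) :
    S.map^[k] x = ((S.map : A →ₗ[ℂ] A) ^ k) x :=
  (Module.End.pow_apply _ _ _).symm

/-- A uniform bound on the powers of the dynamics, obtained by writing `x` as a combination of four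
positive elements. The constant is not optimal. -/
theorem norm_iterate_map_le (S : StateSystem A) (k : ℕ) (x : A) : ‖S.map^[k] x‖ ≤ 4 * ‖x‖ := by
  obtain ⟨y, hy, hy_norm, hxy⟩ := CStarAlgebra.exists_sum_four_nonneg x
  conv_lhs => rw [hxy]
  rw [iterate_map_eq_pow, map_sum]
  refine (norm_sum_le _ _).trans ?_
  calc _ ≤ ∑ _i : Fin 4, ‖x‖ := by
        refine Finset.sum_le_sum fun i _ => ?_
        rw [map_smul, norm_smul, norm_pow, Complex.norm_I, one_pow, one_mul, ← iterate_map_eq_pow]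
        exact (S.norm_iterate_map_le_of_nonneg (hy i) k).trans (hy_norm i)
    _ = 4 * ‖x‖ := by simp

/-! ### Deviations from the invariant state -/

/-- The deviation `ψ(T^k x) - ψ(1) φ(x)`, linear in the algebra element `x`. -/
def deviation (S : StateSystem A) (ψ : StrongDual ℂ A) (k : ℕ) : A →ₗ[ℂ] ℂ :=
  (ψ : A →ₗ[ℂ] ℂ) ∘ₗ (S.map : A →ₗ[ℂ] A) ^ k - ψ 1 • (S.state : A →ₗ[ℂ] ℂ)

/-- The deviation `ψ(T^k x) - ψ(1) φ(x)`, linear in the functional `ψ`. -/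
def dualDeviation (S : StateSystem A) (x : A) (k : ℕ) : StrongDual ℂ A →ₗ[ℂ] ℂ where
  toFun ψ := ψ (S.map^[k] x) - ψ 1 * S.state x
  map_add' ψ χ := by simp only [add_apply]; ring
  map_smul' c ψ := by simp only [smul_apply, smul_eq_mul, RingHom.id_apply]; ring

theorem deviation_apply (S : StateSystem A) (ψ : StrongDual ℂ A) (k : ℕ) (x : A) :
    S.deviation ψ k x = ψ (S.map^[k] x) - ψ 1 * S.state x := by
  rw [iterate_map_eq_pow]; rfl

theorem dualDeviation_apply (S : StateSystem A) (ψ : StrongDual ℂ A) (k : ℕ) (x : A) :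
    S.dualDeviation x k ψ = ψ (S.map^[k] x) - ψ 1 * S.state x := rfl

theorem exists_norm_deviation_le (S : StateSystem A) :
    ∃ C : ℝ, ∀ (ψ : StrongDual ℂ A) (k : ℕ) (x : A),
      ‖ψ (S.map^[k] x) - ψ 1 * S.state x‖ ≤ C * ‖ψ‖ * ‖x‖ := by
  obtain ⟨c, hc⟩ := S.state.exists_norm_apply_le
  refine ⟨4 + ‖(1 : A)‖ * c, fun ψ k x => ?_⟩
  calc ‖ψ (S.map^[k] x) - ψ 1 * S.state x‖
      ≤ ‖ψ (S.map^[k] x)‖ + ‖ψ 1‖ * ‖S.state x‖ :=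
        (norm_sub_le _ _).trans_eq (by rw [norm_mul])
    _ ≤ ‖ψ‖ * (4 * ‖x‖) + (‖ψ‖ * ‖(1 : A)‖) * (c * ‖x‖) := by
        gcongr
        · exact (ψ.le_opNorm _).trans (by gcongr; exact S.norm_iterate_map_le k x)
        · exact ψ.le_opNorm 1
        · exact hc x
    _ = _ := by ring

theorem isClosed_cesaroNull_deviation (S : StateSystem A) (ψ : StrongDual ℂ A) :
    IsClosed (cesaroNull (S.deviation ψ) : Set A) := by
  obtain ⟨C, hC⟩ := S.exists_norm_deviation_le
  refine isClosed_cesaroNull (C := C * ‖ψ‖) fun k x => ?_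
  rw [deviation_apply]
  exact hC ψ k x

theorem isClosed_cesaroNull_dualDeviation (S : StateSystem A) (x : A) :
    IsClosed (cesaroNull (S.dualDeviation x) : Set (StrongDual ℂ A)) := by
  obtain ⟨C, hC⟩ := S.exists_norm_deviation_le
  refine isClosed_cesaroNull (C := C * ‖x‖) fun k ψ => ?_
  rw [dualDeviation_apply]
  exact (hC ψ k x).trans_eq (by ring)

theorem isStrictlyWeakMixing_iff_deviation (S : StateSystem A) :
    S.IsStrictlyWeakMixing ↔ ∀ ψ, cesaroNull (S.deviation ψ) = ⊤ := by
  simp only [IsStrictlyWeakMixing, Submodule.eq_top_iff', mem_cesaroNull, deviation_apply]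
  exact forall_comm

theorem mem_cesaroNull_deviation_iff (S : StateSystem A) (x : A) (ψ : StrongDual ℂ A) :
    x ∈ cesaroNull (S.deviation ψ) ↔ ψ ∈ cesaroNull (S.dualDeviation x) := by
  simp only [mem_cesaroNull, deviation_apply, dualDeviation_apply]

/-! ### Restriction to a subsystem -/

/-- Strict weak mixing passes to subsystems: an embedding of C*-algebras is isometric, so every
bounded functional on the smaller algebra extends to the larger one. -/
theorem IsStrictlyWeakMixing.of_injective {D : Type v} [CStarAlgebra D] [PartialOrder D]
    [StarOrderedRing D] {S : StateSystem A} {Q : StateSystem D} (hQ : Q.IsStrictlyWeakMixing)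
    (j : A →⋆ₐ[ℂ] D) (hj : Function.Injective j) (hmap : ∀ x, j (S.map x) = Q.map (j x))
    (hstate : ∀ x, Q.state (j x) = S.state x) : S.IsStrictlyWeakMixing := by
  intro x ψ
  let J : A →ₗᵢ[ℂ] D := ⟨(j : A →ₐ[ℂ] D).toLinearMap, NonUnitalStarAlgHom.norm_map j hj⟩
  obtain ⟨χ, hχ, -⟩ := exists_extension_norm_eq J.toLinearMap.range
    (ψ.comp J.equivRange.symm.toContinuousLinearEquiv.toContinuousLinearMap)
  have hχj : ∀ a, χ (j a) = ψ a := fun a => by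
    have h := hχ (J.equivRange a)
    change χ (j a) = ψ (J.equivRange.symm (J.equivRange a)) at h
    rwa [LinearIsometryEquiv.symm_apply_apply] at h
  have hiter : ∀ k a, j (S.map^[k] a) = Q.map^[k] (j a) := fun k a =>
    Function.Semiconj.iterate_right hmap k a
  have hone : χ 1 = ψ 1 := by rw [← _root_.map_one j, hχj]
  refine (hQ (j x) χ).congr fun n => ?_
  simp only [← hiter, hχj, hstate, hone]

end StateSystem

/-! ### States separate points -/

section States

variable {A : Type u} [CStarAlgebra A] [PartialOrder A] [StarOrderedRing A]

/-- A real functional that is nonnegative on the positive cone is the restriction to self-adjoint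
elements of a positive complex functional. -/
theorem exists_positive_complexification (f : StrongDual ℝ A) (hf : ∀ a, 0 ≤ a → 0 ≤ f a) :
    ∃ φ : A →ₚ[ℂ] ℂ, ∀ a, IsSelfAdjoint a → φ a = f a := by
  let φ : A →ₗ[ℂ] ℂ :=
    { toFun := fun a => (f (realPart a) : ℂ) + Complex.I * f (imaginaryPart a)
      map_add' := fun a b => by
        simp only [map_add, AddSubgroup.coe_add, Complex.ofReal_add]; ring
      map_smul' := fun c a => by
        simp only [realPart_smul, imaginaryPart_smul, AddSubgroup.coe_add, AddSubgroup.coe_sub,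
          selfAdjoint.val_smul, map_add, map_sub, map_smul, smul_eq_mul, RingHom.id_apply]
        apply Complex.ext <;> simp }
  have hφ : ∀ a, IsSelfAdjoint a → φ a = f a := fun a ha => by
    change (f (realPart a) : ℂ) + Complex.I * f (imaginaryPart a) = f a
    rw [ha.coe_realPart, ha.imaginaryPart]
    simp
  refine ⟨PositiveLinearMap.mk₀ φ fun a ha => ?_, hφ⟩
  rw [hφ a ha.isSelfAdjoint, Complex.zero_le_real]
  exact hf a ha

/-- A nonzero positive element is detected by a state: separate its negative from the closed cone
of positive elements, and normalise. -/
theorem exists_state_apply_ne_zero {h : A} (hh : 0 ≤ h) (h0 : h ≠ 0) :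
    ∃ φ : A →ₚ[ℂ] ℂ, φ 1 = 1 ∧ φ h ≠ 0 := by
  let P : ProperCone ℝ A :=
    { carrier := {a | 0 ≤ a}
      add_mem' := fun ha hb => add_nonneg ha hb
      zero_mem' := le_rfl
      smul_mem' := fun c _ ha => smul_nonneg c.2 ha
      isClosed' := CStarAlgebra.isClosed_nonneg }
  have hP : -h ∉ P := fun hn => h0 (le_antisymm (neg_nonneg.1 hn) hh)
  obtain ⟨f, hf, hfh⟩ := P.hyperplane_separation_point hP
  have hfpos : ∀ a, 0 ≤ a → 0 ≤ f a := hf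
  rw [map_neg, neg_lt_zero] at hfh
  -- `f 1 > 0` because `h` is dominated by a multiple of `1`.
  have hf1 : 0 < f 1 := by
    have h1 : h ≤ ‖h‖ • (1 : A) := by
      rw [← Algebra.algebraMap_eq_smul_one]
      exact IsSelfAdjoint.le_algebraMap_norm_self hh.isSelfAdjoint
    have h2 := hfpos _ (sub_nonneg.2 h1)
    rw [map_sub, map_smul, smul_eq_mul, sub_nonneg] at h2
    exact pos_of_mul_pos_right (hfh.trans_le h2) (norm_nonneg h)
  obtain ⟨φ, hφ⟩ := exists_positive_complexification ((f 1)⁻¹ • f) fun a ha =>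
    mul_nonneg (inv_nonneg.2 hf1.le) (hfpos a ha)
  refine ⟨φ, ?_, ?_⟩
  · rw [hφ 1 (.one A), smul_apply, smul_eq_mul, inv_mul_cancel₀ hf1.ne', Complex.ofReal_one]
  · rw [hφ h hh.isSelfAdjoint, smul_apply, smul_eq_mul, Complex.ofReal_ne_zero]
    exact (mul_pos (inv_pos.2 hf1) hfh).ne'

end States

/-! ### The factors as subsystems of the tensor product -/

section Factors

variable {A : Type u} {B : Type v} [CStarAlgebra A] [PartialOrder A] [StarOrderedRing A]
  [CStarAlgebra B] [PartialOrder B] [StarOrderedRing B]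

variable (A B) in
/-- The embedding `x ↦ x ⊗ 1`. -/
def MinTensor.includeLeft : A →⋆ₐ[ℂ] MinTensor A B where
  __ := (MinTensor.ofAlg A B : A ⊗[ℂ] B →ₐ[ℂ] MinTensor A B).comp
    Algebra.TensorProduct.includeLeft
  map_star' x := by
    change MinTensor.ofAlg A B (star x ⊗ₜ[ℂ] 1) = star (MinTensor.ofAlg A B (x ⊗ₜ[ℂ] 1))
    rw [← map_star, TensorProduct.star_tmul, star_one]

variable (A B) in
/-- The embedding `y ↦ 1 ⊗ y`. -/
def MinTensor.includeRight : B →⋆ₐ[ℂ] MinTensor A B where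
  __ := (MinTensor.ofAlg A B : A ⊗[ℂ] B →ₐ[ℂ] MinTensor A B).comp
    Algebra.TensorProduct.includeRight
  map_star' y := by
    change MinTensor.ofAlg A B (1 ⊗ₜ[ℂ] star y) = star (MinTensor.ofAlg A B (1 ⊗ₜ[ℂ] y))
    rw [← map_star, TensorProduct.star_tmul, star_one]

theorem MinTensor.includeLeft_apply (x : A) :
    MinTensor.includeLeft A B x = MinTensor.tmul x 1 := rfl

theorem MinTensor.includeRight_apply (y : B) :
    MinTensor.includeRight A B y = MinTensor.tmul 1 y := rfl

/-- The kernel is trivial because product states `φ ⊗ ψ` restrict to arbitrary states `φ`. -/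
theorem MinTensor.includeLeft_injective (ψ : B →ₚ[ℂ] ℂ) (hψ : ψ 1 = 1) :
    Function.Injective (MinTensor.includeLeft A B) := by
  rw [injective_iff_map_eq_zero]
  intro x hx
  by_contra h0
  obtain ⟨φ, hφ1, hφ⟩ := exists_state_apply_ne_zero (star_mul_self_nonneg x)
    (mt (CStarRing.star_mul_self_eq_zero_iff x).1 h0)
  obtain ⟨ω, hω, -⟩ := existsUnique_tensorState φ ψ hφ1 hψ
  have h1 := hω (star x * x) 1
  rw [← MinTensor.includeLeft_apply, map_mul, hx, mul_zero, map_zero, hψ, mul_one] at h1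
  exact hφ h1.symm

theorem MinTensor.includeRight_injective (φ : A →ₚ[ℂ] ℂ) (hφ : φ 1 = 1) :
    Function.Injective (MinTensor.includeRight A B) := by
  rw [injective_iff_map_eq_zero]
  intro y hy
  by_contra h0
  obtain ⟨ψ, hψ1, hψ⟩ := exists_state_apply_ne_zero (star_mul_self_nonneg y)
    (mt (CStarRing.star_mul_self_eq_zero_iff y).1 h0)
  obtain ⟨ω, hω, -⟩ := existsUnique_tensorState φ ψ hφ hψ1
  have h1 := hω 1 (star y * y)
  rw [← MinTensor.includeRight_apply, map_mul, hy, mul_zero, map_zero, hφ, one_mul] at h1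
  exact hψ h1.symm

namespace StateSystem

variable {S : StateSystem A} {R : StateSystem B}

theorem IsStrictlyWeakMixing.of_tensor_left (h : (S.tensor R).IsStrictlyWeakMixing) :
    S.IsStrictlyWeakMixing := by
  refine h.of_injective (MinTensor.includeLeft A B)
    (MinTensor.includeLeft_injective R.state R.state_one) (fun x => ?_) fun x => ?_
  · change MinTensor.tmul (S.map x) 1 = S.tensorMap R (MinTensor.tmul x 1)
    rw [tensorMap_tmul, R.map_one]
  · change S.tensorState R (MinTensor.tmul x 1) = S.state x
    rw [tensorState_tmul, R.state_one, mul_one]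

theorem IsStrictlyWeakMixing.of_tensor_right (h : (S.tensor R).IsStrictlyWeakMixing) :
    R.IsStrictlyWeakMixing := by
  refine h.of_injective (MinTensor.includeRight A B)
    (MinTensor.includeRight_injective S.state S.state_one) (fun y => ?_) fun y => ?_
  · change MinTensor.tmul 1 (R.map y) = S.tensorMap R (MinTensor.tmul 1 y)
    rw [tensorMap_tmul, S.map_one]
  · change S.tensorState R (MinTensor.tmul 1 y) = R.state y
    rw [tensorState_tmul, S.state_one, one_mul]

/-! ### The tensor product of mixing systems -/

theorem tensor_iterate_map_tmul (S : StateSystem A) (R : StateSystem B) (x : A) (y : B) (k : ℕ) :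
    (S.tensor R).map^[k] (MinTensor.tmul x y) =
      MinTensor.tmul (S.map^[k] x) (R.map^[k] y) := by
  induction k with
  | zero => rfl
  | succ k ih =>
    simp only [Function.iterate_succ_apply', ih]
    exact S.tensorMap_tmul R _ _

theorem tmul_mem_cesaroNull_deviation (hS : S.IsStrictlyWeakMixing) (hR : R.IsStrictlyWeakMixing)
    {ω : StrongDual ℂ (MinTensor A B)} {ψ : StrongDual ℂ A} {φ : StrongDual ℂ B}
    (hω : ∀ x y, ω (MinTensor.tmul x y) = ψ x * φ y) (x : A) (y : B) :
    MinTensor.tmul x y ∈ cesaroNull ((S.tensor R).deviation ω) := by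
  have hbound : ∀ k, ‖φ (R.map^[k] y)‖ ≤ ‖φ‖ * (4 * ‖y‖) := fun k =>
    (φ.le_opNorm _).trans (by gcongr; exact R.norm_iterate_map_le k y)
  refine mem_cesaroNull.2 ((tendsto_cesaro_norm_mul hbound (hS x ψ) (hR y φ)).congr fun n => ?_)
  have hstate : (S.tensor R).state (MinTensor.tmul x y) = S.state x * R.state y :=
    S.tensorState_tmul R x y
  simp only [deviation_apply, tensor_iterate_map_tmul, hω, hstate, ← MinTensor.tmul_one_one,
    mul_mul_mul_comm]

theorem cesaroNull_deviation_eq_top (hS : S.IsStrictlyWeakMixing) (hR : R.IsStrictlyWeakMixing)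
    {ω : StrongDual ℂ (MinTensor A B)} {ψ : StrongDual ℂ A} {φ : StrongDual ℂ B}
    (hω : ∀ x y, ω (MinTensor.tmul x y) = ψ x * φ y) :
    cesaroNull ((S.tensor R).deviation ω) = ⊤ := by
  rw [Submodule.eq_top_iff']
  intro z
  refine MinTensor.denseRange_ofAlg.induction_on z
    ((S.tensor R).isClosed_cesaroNull_deviation ω) fun w => ?_
  induction w using TensorProduct.induction_on with
  | zero => rw [map_zero]; exact Submodule.zero_mem _
  | tmul x y => exact tmul_mem_cesaroNull_deviation hS hR hω x y
  | add v w hv hw => rw [map_add]; exact Submodule.add_mem _ hv hw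

theorem IsStrictlyWeakMixing.tensor (hS : S.IsStrictlyWeakMixing) (hR : R.IsStrictlyWeakMixing)
    (hAB : dualTensor A B = ⊤) : (S.tensor R).IsStrictlyWeakMixing := by
  rw [isStrictlyWeakMixing_iff_deviation]
  intro ω
  rw [Submodule.eq_top_iff']
  intro z
  rw [mem_cesaroNull_deviation_iff]
  have hle : dualTensor A B ≤ cesaroNull ((S.tensor R).dualDeviation z) := by
    refine Submodule.topologicalClosure_minimal _ (Submodule.span_le.2 ?_)
      ((S.tensor R).isClosed_cesaroNull_dualDeviation z)
    rintro χ ⟨ψ, φ, hχ⟩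
    rw [SetLike.mem_coe, ← mem_cesaroNull_deviation_iff, cesaroNull_deviation_eq_top hS hR hχ]
    exact Submodule.mem_top
  exact hle (hAB ▸ Submodule.mem_top)

end StateSystem

end Factors

end

end CStarMixing

theorem mainTheorem1 {A : Type*} {B : Type*}
    [CStarAlgebra A] [PartialOrder A] [StarOrderedRing A]
    [CStarAlgebra B] [PartialOrder B] [StarOrderedRing B]
    (S : CStarMixing.StateSystem A) (R : CStarMixing.StateSystem B) :
    ((S.tensor R).IsStrictlyWeakMixing →
      S.IsStrictlyWeakMixing ∧ R.IsStrictlyWeakMixing) ∧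
    (CStarMixing.dualTensor A B = ⊤ →
      S.IsStrictlyWeakMixing ∧ R.IsStrictlyWeakMixing →
        (S.tensor R).IsStrictlyWeakMixing) :=
  ⟨fun h => ⟨h.of_tensor_left, h.of_tensor_right⟩, fun hAB h => h.1.tensor h.2 hAB⟩
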